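/- Let $\Sigma$ be a compact metric space with its Borel $\sigma$-algebra, let $K$ be a Markov kernel on $\Sigma$, and let $K^n$ denote its iterates. Given a $K$-stationary probability measure $\mu$, the pair $(K,\mu)$ is called strongly mixing if there are $C_0>0$ and $0<\rho<1$ such that $$\Big|\int_\Sigma f(y)\,K^n(x,dy)-\int_\Sigma f\,d\mu\Big|\le C_0\,\rho^n\,\|f\|_\infty$$ for all bounded measurable $f:\Sigma\to\mathbb{C}$, all $x\in\Sigma$ and all $n\in\mathbb{N}$, where $\|\cdot\|_\infty$ is the sup norm. Let $X=\Sigma^{\mathbb{Z}}$ with the shift $(Tx)_n=x_{n+1}$, and let $\mathbb{P}_\mu$ be the Kolmogorov extension of $(K,\mu)$, i.e. the unique $T$-invariant probability measure on $X$ whose projection to $\Sigma^{\mathbb{N}}$ is the law of the Markov chain with initial distribution $\mu$ and transition kernel $K$; write $\mathbb{E}_\mu(\xi)=\int_X\xi\,d\mathbb{P}_\mu$. On $X$ consider the metric $\widetilde d(x,x')=2^{-\inf\{|k|\,:\,k\in\mathbb{Z},\ x_k\ne x'_k\}}$ (with $\widetilde d(x,x)=0$). For $\alpha>0$ and a bounded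 measurable $f:X\to\mathbb{C}$ put $$v_k(f)=\sup\{|f(x)-f(y)|:\widetilde d(x,y)\le 2^{-k}\},\qquad v_\alpha(f)=\sup_{k\in\mathbb{N}}2^{\alpha k}v_k(f),\qquad \|f\|_\alpha=\|f\|_\infty+v_\alpha(f),$$ and let $\mathscr{H}_\alpha(X^-)$ be the set of those bounded measurable $f$ with $v_\alpha(f)<\infty$ that are future independent, i.e. $f(x)=f(y)$ whenever $x_k=y_k$ for all $k\le 0$. **Theorem.** Let $K$ be a Markov kernel on $\Sigma$, let $0<\alpha\le 1$ and let $L\in\mathbb{R}$. There exist constants $C>0$, $k>0$ and $\varepsilon_0>0$, depending only on $K$, $\alpha$ and $L$, such that for every $K$-stationary probability measure $\mu$ for which $(K,\mu)$ is strongly mixing, every $\xi\in\mathscr{H}_\alpha(X^-)$ with $\|\xi\|_\alpha\le L$, every $0<\varepsilon<\varepsilon_0$ and every integer $n\ge 1$, $$\mathbb{P}_\mu\Big[\,\Big|\frac1n\sum_{j=0}^{n-1}\xi\circ T^j-\mathbb{E}_\mu(\xi)\Big|>\varepsilon\,\Big]\le C\,e^{-k\,\varepsilon^2\,n}.$$ 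-/

import Mathlib

open MeasureTheory ProbabilityTheory Topology Filter
open scoped ENNReal

namespace MarkovShift

/-! ### Sup norm and the strong mixing property -/

section Mixing

variable {S : Type*} [MeasurableSpace S]

/-- The sup norm of a complex function, with value `∞` on unbounded functions. -/
noncomputable def supNorm {Y : Type*} (f : Y → ℂ) : ℝ≥0∞ := ⨆ y, ‖f y‖ₑ

/-- The space `L^∞(Y)` of bounded measurable complex functions (everywhere defined). -/
def MemLInfty {Y : Type*} [MeasurableSpace Y] (f : Y → ℂ) : Prop :=
  Measurable f ∧ supNorm f < ∞

/-- `(K, μ)` is strongly mixing: `K^n f` converges to `∫ f dμ` uniformly on `S`, at a geometric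
rate, for all bounded measurable `f`. Here `K ^ n` is the `n`-step transition kernel. -/
def StronglyMixing (K : Kernel S S) (μ : Measure S) : Prop :=
  ∃ C > (0 : ℝ), ∃ ρ : ℝ, 0 < ρ ∧ ρ < 1 ∧
    ∀ f : S → ℂ, MemLInfty f → ∀ (x : S) (n : ℕ),
      ‖(∫ y, f y ∂((K ^ n) x)) - ∫ y, f y ∂μ‖ ≤ C * ρ ^ n * (supNorm f).toReal

end Mixing

/-! ### The Kolmogorov extensions of a Markov system -/

section Extension

variable {S : Type*}

/-- The two-sided shift `(T x)_n = x_{n+1}`. -/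
def shift (x : ℤ → S) : ℤ → S := fun n => x (n + 1)

/-- The one-sided shift `(T x)_n = x_{n+1}`. -/
def shiftPlus (x : ℕ → S) : ℕ → S := fun n => x (n + 1)

/-- The projection `X → X⁺` that keeps the coordinates with non-negative index. -/
def projPlus (x : ℤ → S) : ℕ → S := fun n => x n

lemma iterate_shift_apply (n : ℕ) (x : ℤ → S) (k : ℤ) : (shift^[n] x) k = x (k + n) := by
  induction n generalizing x k with
  | zero => simp
  | succ n ih =>
    rw [Function.iterate_succ_apply, ih]
    simp only [shift]
    congr 1
    push_cast
    ring

variable [MeasurableSpace S]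

/-- The transition kernel `K`, regarded as the conditional law of the state at time `n + 1` given
the states at times `0, …, n`: it uses the state at time `n` only. -/
noncomputable def stepKernel (K : Kernel S S) (n : ℕ) :
    Kernel ((i : Finset.Iic n) → (fun _ : ℕ => S) i) S :=
  K.comap (fun x => x ⟨n, Finset.mem_Iic.2 le_rfl⟩) (measurable_pi_apply _)

instance (K : Kernel S S) [IsMarkovKernel K] (n : ℕ) : IsMarkovKernel (stepKernel K n) := by
  unfold stepKernel; infer_instance

/-- The law `ℙ_θ⁺` on `S^ℕ` of the Markov chain with initial distribution `θ` and transition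
kernel `K`. -/
noncomputable def pathMeasurePlus (K : Kernel S S) [IsMarkovKernel K] (θ : Measure S) :
    Measure (ℕ → S) :=
  Kernel.trajMeasure (X := fun _ : ℕ => S) θ (fun n => stepKernel K n)

instance (K : Kernel S S) [IsMarkovKernel K] (θ : Measure S) [IsProbabilityMeasure θ] :
    IsProbabilityMeasure (pathMeasurePlus K θ) := by
  unfold pathMeasurePlus; infer_instance

lemma measurable_shift : Measurable (shift : (ℤ → S) → ℤ → S) :=
  measurable_pi_lambda _ fun _ => measurable_pi_apply _

lemma measurable_shiftPlus : Measurable (shiftPlus : (ℕ → S) → ℕ → S) :=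
  measurable_pi_lambda _ fun _ => measurable_pi_apply _

lemma measurable_projPlus : Measurable (projPlus : (ℤ → S) → ℕ → S) :=
  measurable_pi_lambda _ fun _ => measurable_pi_apply _

/-- The chain starts with the law `θ`. -/
lemma pathMeasurePlus_map_zero (K : Kernel S S) [IsMarkovKernel K] (θ : Measure S)
    [IsProbabilityMeasure θ] : (pathMeasurePlus K θ).map (fun x => x 0) = θ := by
  have h : (pathMeasurePlus K θ).map (Preorder.frestrictLe (π := fun _ : ℕ => S) 0)
      = θ.map (MeasurableEquiv.piUnique (fun _ : Finset.Iic 0 => S)).symm := by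
    rw [pathMeasurePlus, Kernel.trajMeasure, Measure.map_comp _ _ (by fun_prop),
      Kernel.traj_map_frestrictLe, Kernel.partialTraj_self, Measure.id_comp]
  have h2 : (fun x : ℕ → S => x 0) = (MeasurableEquiv.piUnique (fun _ : Finset.Iic 0 => S)) ∘
      (Preorder.frestrictLe (π := fun _ : ℕ => S) 0) := by
    funext x; rfl
  rw [h2, ← Measure.map_map (by fun_prop) (by fun_prop), h, Measure.map_map (by fun_prop)
    (by fun_prop), MeasurableEquiv.self_comp_symm, Measure.map_id]

/-- The Markov property: given the states up to time `n`, the next state has law `K (x_n, ·)`. -/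
lemma pathMeasurePlus_step (K : Kernel S S) [IsMarkovKernel K] (θ : Measure S)
    [IsProbabilityMeasure θ] (n : ℕ) :
    (pathMeasurePlus K θ).map (Preorder.frestrictLe (π := fun _ : ℕ => S) n) ⊗ₘ stepKernel K n =
      (pathMeasurePlus K θ).map
        (fun x => (Preorder.frestrictLe (π := fun _ : ℕ => S) n x, x (n + 1))) :=
  Kernel.map_frestrictLe_trajMeasure_compProd_eq_map_trajMeasure

/-- Two probability measures on `S^ℕ` with the same initial law that have the Markov property for
`K` coincide. -/
lemma eq_of_markov (K : Kernel S S) [IsMarkovKernel K] {P Q : Measure (ℕ → S)}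
    [IsProbabilityMeasure P] [IsProbabilityMeasure Q]
    (h0 : P.map (fun x => x 0) = Q.map (fun x => x 0))
    (hP : ∀ n : ℕ, P.map (Preorder.frestrictLe (π := fun _ : ℕ => S) n) ⊗ₘ stepKernel K n =
      P.map (fun x => (Preorder.frestrictLe (π := fun _ : ℕ => S) n x, x (n + 1))))
    (hQ : ∀ n : ℕ, Q.map (Preorder.frestrictLe (π := fun _ : ℕ => S) n) ⊗ₘ stepKernel K n =
      Q.map (fun x => (Preorder.frestrictLe (π := fun _ : ℕ => S) n x, x (n + 1)))) :
    P = Q := by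
  have key : ∀ n : ℕ, P.map (Preorder.frestrictLe (π := fun _ : ℕ => S) n)
      = Q.map (Preorder.frestrictLe (π := fun _ : ℕ => S) n) := by
    intro n
    induction n with
    | zero =>
      have h2 : (Preorder.frestrictLe (π := fun _ : ℕ => S) 0) =
          (MeasurableEquiv.piUnique (fun _ : Finset.Iic 0 => S)).symm ∘
            (fun x : ℕ → S => x 0) := by
        funext x
        apply (MeasurableEquiv.piUnique (fun _ : Finset.Iic 0 => S)).injective
        simp
        rfl
      rw [h2, ← Measure.map_map (by fun_prop) (by fun_prop), h0, Measure.map_map (by fun_prop)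
        (by fun_prop)]
    | succ n ih =>
      have h3 : P.map (fun x => (Preorder.frestrictLe (π := fun _ : ℕ => S) n x, x (n + 1)))
          = Q.map (fun x => (Preorder.frestrictLe (π := fun _ : ℕ => S) n x, x (n + 1))) := by
        rw [← hP n, ← hQ n, ih]
      let g : ((i : Finset.Iic n) → (fun _ : ℕ => S) i) × S → (Finset.Iic (n + 1) → S) :=
        fun p i => if h : (i : ℕ) ≤ n then p.1 ⟨i, Finset.mem_Iic.2 h⟩ else p.2
      have hg : Measurable g := by
        refine measurable_pi_lambda _ fun i => ?_
        by_cases h : (i : ℕ) ≤ n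
        · simp only [g, h, dif_pos]; fun_prop
        · simp only [g, h, dif_neg, not_false_eq_true]; fun_prop
      have h4 : (Preorder.frestrictLe (π := fun _ : ℕ => S) (n + 1)) =
          g ∘ (fun x : ℕ → S => (Preorder.frestrictLe (π := fun _ : ℕ => S) n x, x (n + 1))) := by
        funext x i
        by_cases h : (i : ℕ) ≤ n
        · simp [g, h]
        · have hi : (i : ℕ) = n + 1 := by
            have := Finset.mem_Iic.1 i.2
            omega
          simp [g, hi]
      rw [h4, ← Measure.map_map hg (by fun_prop), h3, Measure.map_map hg (by fun_prop)]
  refine IsProjectiveLimit.unique (P := fun I => Q.map I.restrict) (fun I => ?_) (fun I => rfl)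
  have hI : I ⊆ Finset.Iic (I.sup id) := I.subset_Iic_sup_id
  have h5 : (I.restrict : (ℕ → S) → _) = Finset.restrict₂ (π := fun _ : ℕ => S) hI ∘
      Preorder.frestrictLe (π := fun _ : ℕ => S) (I.sup id) := rfl
  have hm : Measurable (Finset.restrict₂ (π := fun _ : ℕ => S) hI) :=
    Finset.measurable_restrict₂ hI
  change _ = Q.map I.restrict
  rw [h5, ← Measure.map_map hm (by fun_prop), key, Measure.map_map hm (by fun_prop)]

/-- The law of the chain started with a stationary measure is invariant under the shift. -/
lemma pathMeasurePlus_map_shiftPlus (K : Kernel S S) [IsMarkovKernel K] (μ : Measure S)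
    [IsProbabilityMeasure μ] (hμ : K.Invariant μ) :
    (pathMeasurePlus K μ).map shiftPlus = pathMeasurePlus K μ := by
  have hs : Measurable (shiftPlus : (ℕ → S) → ℕ → S) := measurable_shiftPlus
  have : IsProbabilityMeasure ((pathMeasurePlus K μ).map shiftPlus) :=
    Measure.isProbabilityMeasure_map hs.aemeasurable
  refine eq_of_markov K ?_ (fun n => ?_) (pathMeasurePlus_step K μ)
  · rw [pathMeasurePlus_map_zero, Measure.map_map (by fun_prop) hs]
    have h1 := congrArg (fun m => m.map Prod.snd) (pathMeasurePlus_step K μ 0)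
    beta_reduce at h1
    rw [Measure.map_map (by fun_prop) (by fun_prop)] at h1
    change _ = (pathMeasurePlus K μ).map ((fun x => x 0) ∘ shiftPlus) at h1
    rw [← h1]
    ext A hA
    have hA' : MeasurableSet (Prod.snd ⁻¹' A :
      Set (((i : Finset.Iic 0) → (fun _ : ℕ => S) i) × S)) := measurable_snd hA
    rw [Measure.map_apply measurable_snd hA, Measure.compProd_apply hA',
      lintegral_map (Kernel.measurable_kernel_prodMk_left hA') (by fun_prop)]
    have h6 := pathMeasurePlus_map_zero K μ
    have h7 : μ A = ∫⁻ y, K y A ∂μ := by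
      conv_lhs => rw [← hμ]
      exact Measure.bind_apply hA K.aemeasurable
    rw [h7]
    conv_rhs => rw [← h6]
    rw [lintegral_map (K.measurable_coe hA) (by fun_prop)]
    rfl
  · let g : (Finset.Iic (n + 1) → S) → (Finset.Iic n → S) :=
      fun x i => x ⟨i + 1, Finset.mem_Iic.2 (Nat.succ_le_succ (Finset.mem_Iic.1 i.2))⟩
    have hg : Measurable g := measurable_pi_lambda _ fun i => measurable_pi_apply _
    have e1 : ((pathMeasurePlus K μ).map shiftPlus).map
        (Preorder.frestrictLe (π := fun _ : ℕ => S) n) =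
        ((pathMeasurePlus K μ).map (Preorder.frestrictLe (π := fun _ : ℕ => S) (n + 1))).map g := by
      rw [Measure.map_map (by fun_prop) hs, Measure.map_map hg (by fun_prop)]
      rfl
    have e2 : ((pathMeasurePlus K μ).map shiftPlus).map
        (fun x => (Preorder.frestrictLe (π := fun _ : ℕ => S) n x, x (n + 1))) =
        ((pathMeasurePlus K μ).map (fun x =>
          (Preorder.frestrictLe (π := fun _ : ℕ => S) (n + 1) x, x (n + 1 + 1)))).map
          (Prod.map g id) := by
      rw [Measure.map_map (by fun_prop) hs, Measure.map_map (by fun_prop) (by fun_prop)]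
      rfl
    rw [e1, e2, ← pathMeasurePlus_step]
    have : IsProbabilityMeasure ((pathMeasurePlus K μ).map
        (Preorder.frestrictLe (π := fun _ : ℕ => S) (n + 1))) :=
      Measure.isProbabilityMeasure_map (by fun_prop)
    have : IsProbabilityMeasure (((pathMeasurePlus K μ).map
        (Preorder.frestrictLe (π := fun _ : ℕ => S) (n + 1))).map g) :=
      Measure.isProbabilityMeasure_map (by fun_prop)
    ext A hA
    have hm : Measurable (Prod.map g (id : S → S)) := by fun_prop
    rw [Measure.compProd_apply hA, Measure.map_apply hm hA, Measure.compProd_apply (hm hA),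
      lintegral_map (Kernel.measurable_kernel_prodMk_left hA) hg]
    rfl

/-- The coordinates with index at least `-n`, as a one-sided sequence. -/
def projFrom (n : ℕ) (x : ℤ → S) : ℕ → S := fun k => x (k - n)

lemma measurable_projFrom (n : ℕ) : Measurable (projFrom n : (ℤ → S) → ℕ → S) :=
  measurable_pi_lambda _ fun _ => measurable_pi_apply _

lemma eq_of_projFrom {P Q : Measure (ℤ → S)} [IsProbabilityMeasure P] [IsProbabilityMeasure Q]
    (h : ∀ n, P.map (projFrom n) = Q.map (projFrom n)) : P = Q := by
  refine IsProjectiveLimit.unique (P := fun I => Q.map I.restrict) (fun I => ?_) (fun I => rfl)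
  let n : ℕ := I.sup Int.natAbs
  let g : (ℕ → S) → (I → S) := fun x i => x ((i : ℤ) + n).toNat
  have hg : Measurable g := measurable_pi_lambda _ fun i => measurable_pi_apply _
  have h5 : (I.restrict : (ℤ → S) → _) = g ∘ projFrom n := by
    funext x i
    have hi : (i : ℤ).natAbs ≤ n := Finset.le_sup (f := Int.natAbs) i.2
    have : (((i : ℤ) + n).toNat : ℤ) - n = i := by omega
    simp only [g, projFrom, Function.comp, this, Finset.restrict]
  change _ = Q.map I.restrict
  rw [h5, ← Measure.map_map hg (measurable_projFrom n), h,
    Measure.map_map hg (measurable_projFrom n)]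

lemma projFrom_of_invariant {P : Measure (ℤ → S)} (hT : P.map shift = P) (n : ℕ) :
    P.map (projFrom n) = P.map projPlus := by
  have hmp : MeasurePreserving (shift : (ℤ → S) → ℤ → S) P P := ⟨measurable_shift, hT⟩
  have hn := hmp.iterate n
  conv_lhs => rw [← hn.map_eq]
  rw [Measure.map_map (measurable_projFrom n) hn.measurable]
  congr 1
  funext x k
  simp [projFrom, projPlus, iterate_shift_apply]

variable [MetricSpace S] [CompactSpace S] [BorelSpace S]

/-- Existence and uniqueness of the two-sided Kolmogorov extension of a Markov system. -/
theorem existsUnique_kolmogorovExtension (K : Kernel S S) [IsMarkovKernel K] (μ : Measure S)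
    [IsProbabilityMeasure μ] (hμ : K.Invariant μ) :
    ∃! P : Measure (ℤ → S), IsProbabilityMeasure P ∧ P.map shift = P ∧
      P.map projPlus = pathMeasurePlus K μ := by
  refine existsUnique_of_exists_of_unique ?_ ?_
  · let PP : ProbabilityMeasure (ℕ → S) := ⟨pathMeasurePlus K μ, inferInstance⟩
    let emb : ℕ → (ℕ → S) → (ℤ → S) := fun n x k => x (k + n).toNat
    have hemb : ∀ n, Measurable (emb n) := fun n =>
      measurable_pi_lambda _ fun i => measurable_pi_apply _
    let Q : ℕ → ProbabilityMeasure (ℤ → S) := fun n => PP.map (hemb n).aemeasurable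
    have hc : ∀ n, Continuous (projFrom n : (ℤ → S) → ℕ → S) := fun n =>
      continuous_pi fun k => continuous_apply _
    have hit : ∀ m : ℕ, (pathMeasurePlus K μ).map (shiftPlus^[m]) = pathMeasurePlus K μ := by
      intro m
      have hmp : MeasurePreserving (shiftPlus : (ℕ → S) → ℕ → S) (pathMeasurePlus K μ)
        (pathMeasurePlus K μ) := ⟨measurable_shiftPlus, pathMeasurePlus_map_shiftPlus K μ hμ⟩
      exact (hmp.iterate m).map_eq
    have hit' : ∀ (m : ℕ) (x : ℕ → S) (k : ℕ), (shiftPlus^[m] x) k = x (k + m) := by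
      intro m
      induction m with
      | zero => intro x k; rfl
      | succ m ih =>
        intro x k
        rw [Function.iterate_succ_apply, ih]
        simp only [shiftPlus]
        congr 1
    have hQ : ∀ n m, n ≤ m → (Q m).map (hc n).measurable.aemeasurable = PP := by
      intro n m hnm
      apply Subtype.ext
      change ((pathMeasurePlus K μ).map (emb m)).map (projFrom n) = pathMeasurePlus K μ
      rw [Measure.map_map (hc n).measurable (hemb m)]
      conv_rhs => rw [← hit (m - n)]
      congr 1
      funext x k
      rw [hit']
      simp only [emb, projFrom, Function.comp]
      congr 1
      omega
    obtain ⟨P, hP⟩ := exists_clusterPt_of_compactSpace (map Q atTop)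
    have hP' : ∀ n, (P : Measure (ℤ → S)).map (projFrom n) = pathMeasurePlus K μ := by
      intro n
      have hcl : IsClosed {ν : ProbabilityMeasure (ℤ → S) |
          ν.map (hc n).measurable.aemeasurable = PP} :=
        isClosed_eq (ProbabilityMeasure.continuous_map (hc n)) continuous_const
      have hmem : P ∈ {ν : ProbabilityMeasure (ℤ → S) |
          ν.map (hc n).measurable.aemeasurable = PP} := by
        refine hcl.mem_of_mapClusterPt hP ?_
        filter_upwards [eventually_ge_atTop n] with m hm using hQ n m hm
      exact congrArg Subtype.val hmem
    refine ⟨P, inferInstance, ?_, ?_⟩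
    · have : IsProbabilityMeasure ((P : Measure (ℤ → S)).map shift) :=
        Measure.isProbabilityMeasure_map measurable_shift.aemeasurable
      refine eq_of_projFrom fun n => ?_
      rw [Measure.map_map (measurable_projFrom n) measurable_shift, hP' n]
      have e : projFrom n ∘ (shift : (ℤ → S) → ℤ → S) = shiftPlus ∘ projFrom n := by
        funext x k
        simp only [projFrom, shift, shiftPlus, Function.comp]
        congr 1
        push_cast
        ring
      rw [e, ← Measure.map_map measurable_shiftPlus (measurable_projFrom n), hP' n,
        pathMeasurePlus_map_shiftPlus K μ hμ]
    · have e : (projPlus : (ℤ → S) → ℕ → S) = projFrom 0 := by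
        funext x k
        simp [projFrom, projPlus]
      rw [e, hP' 0]
  · rintro P Q ⟨_, hPT, hPp⟩ ⟨_, hQT, hQp⟩
    refine eq_of_projFrom fun n => ?_
    rw [projFrom_of_invariant hPT, projFrom_of_invariant hQT, hPp, hQp]

/-- The Kolmogorov extension `ℙ_μ` of the Markov system `(K, μ)`: the unique shift-invariant
probability measure on `S^ℤ` that projects to the law `ℙ_μ⁺` of the chain on `S^ℕ`. -/
noncomputable def kolmogorovExtension (K : Kernel S S) [IsMarkovKernel K] (μ : Measure S)
    [IsProbabilityMeasure μ] (hμ : K.Invariant μ) : Measure (ℤ → S) :=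
  (existsUnique_kolmogorovExtension K μ hμ).choose

lemma kolmogorovExtension_spec (K : Kernel S S) [IsMarkovKernel K] (μ : Measure S)
    [IsProbabilityMeasure μ] (hμ : K.Invariant μ) :
    IsProbabilityMeasure (kolmogorovExtension K μ hμ) ∧
      (kolmogorovExtension K μ hμ).map shift = kolmogorovExtension K μ hμ ∧
      (kolmogorovExtension K μ hμ).map projPlus = pathMeasurePlus K μ :=
  (existsUnique_kolmogorovExtension K μ hμ).choose_spec.1

end Extension

/-! ### Hölder observables on the space of two-sided sequences -/

section Holder

variable {S : Type*}

open Classical in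
/-- The metric `d̃(x, x') = 2 ^ (- inf {|k| : x_k ≠ x'_k})` on `S^ℤ`, with `d̃(x, x) = 0`. -/
noncomputable def dTilde (x x' : ℤ → S) : ℝ :=
  if x = x' then 0 else ((2 : ℝ) ^ sInf {m : ℕ | ∃ k : ℤ, x k ≠ x' k ∧ m = k.natAbs})⁻¹

/-- `v_k(f) = sup {|f(x) - f(y)| : d̃(x, y) ≤ 2^{-k}}`. -/
noncomputable def oscAt (k : ℕ) (f : (ℤ → S) → ℂ) : ℝ≥0∞ :=
  ⨆ (x : ℤ → S) (y : ℤ → S) (_ : dTilde x y ≤ ((2 : ℝ) ^ k)⁻¹), ‖f x - f y‖ₑ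

/-- `v_α(f) = sup_k 2^{α k} v_k(f)`. -/
noncomputable def holderSeminorm (α : ℝ) (f : (ℤ → S) → ℂ) : ℝ≥0∞ :=
  ⨆ k : ℕ, ENNReal.ofReal ((2 : ℝ) ^ (α * k)) * oscAt k f

/-- `‖f‖_α = ‖f‖_∞ + v_α(f)`. -/
noncomputable def holderNorm (α : ℝ) (f : (ℤ → S) → ℂ) : ℝ≥0∞ :=
  supNorm f + holderSeminorm α f

/-- `f` is future independent: `f(x)` depends only on the coordinates `x_k` with `k ≤ 0`. -/
def FutureIndependent (f : (ℤ → S) → ℂ) : Prop :=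
  ∀ x y : ℤ → S, (∀ k : ℤ, k ≤ 0 → x k = y k) → f x = f y

/-- The space `ℋ_α(X⁻)`: bounded measurable functions on `S^ℤ` that are `α`-Hölder for `d̃` and
future independent. -/
def MemHolderPast [MeasurableSpace S] (α : ℝ) (f : (ℤ → S) → ℂ) : Prop :=
  MemLInfty f ∧ holderSeminorm α f < ∞ ∧ FutureIndependent f

end Holder

end MarkovShift

/-!
The pasts `(…, x_{-1}, x_0)` of the sequences in `S^ℤ` form a Markov chain: from the past `x` one
moves to `append x y` with `y` of law `K (x 0)`. Its transition operator on functions of the past is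
`pastOp K`, and the law of the past under `ℙ_μ` is stationary for it (`integral_pastOp`). No
stationary measure enters the definition of `pastOp K`.

*Bounded expected sums.* Let `f` be the real part of `ξ - 𝔼 ξ` (or its imaginary part, or the
negative of one of them). After `b` transitions a Hölder function of the past is within
`O(2^{-α b})` of a function of the present coordinate, because the old past has been pushed out of
the window `[-b, 0]`; after `a` more transitions the mixing of `K` brings a function of the present
within `O(ρ^a)` of a constant. With `a` and `b` about `j / 2`, the `j`-th iterate of `pastOp K` on
the centered function `f` decays geometrically, so `u_m = ∑_{j < m} (pastOp K)^j f`, called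
`expectedSum K f m`, is bounded by a constant `M` that does not depend on `m` or `μ`
(`abs_expectedSum_le`). The constants of mixing can be chosen to depend on `K` alone, since
`|K^n φ (s) - K^n φ (s')|` is controlled without reference to the stationary measure
(`StronglyMixing.exists_abs_integral_sub_le`).

*The exponential moment.* Since `u_{m+1} = f + pastOp K u_m`, integrating out the last transition in
`𝔼 exp (t S_{n+1} + t u_m)`, where `u_m` is evaluated at the past following the `n + 1` summed ones,
gives by Hoeffding's lemma at most `exp (M² t² / 2) 𝔼 exp (t S_n + t u_{m+1})`
(`integral_exp_backwardSum_succ_le`). By shift invariance the sums can be taken over the preceding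
sequences, so that everything is a function of the past. Hence
`𝔼 exp (t S_n) ≤ exp (n M² t² / 2 + t M)`, and the Chernoff bound with `t = ε / M²` gives
the deviation inequality for `f` (`measureReal_le_sum_shift_le`), with four such bounds for `ξ`.
-/

namespace MarkovShift

/-! ### The Markov chain of pasts -/

section PastChain

variable {S : Type*}

/-- The two-sided sequence whose past (the coordinates `k ≤ 0`) is the past of `x` moved one step
to the left, followed by `y` at the coordinate `0`. The positive coordinates are irrelevant for
functions of the past; they are filled with `y`. -/
def append (x : ℤ → S) (y : S) : ℤ → S := fun k => if k < 0 then x (k + 1) else y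

/-- The sequence `x` with its future replaced by the constant `x 0`. -/
def truncFuture (x : ℤ → S) : ℤ → S := fun k => x (min k 0)

lemma append_of_neg (x : ℤ → S) (y : S) {k : ℤ} (hk : k < 0) : append x y k = x (k + 1) :=
  if_pos hk

@[simp] lemma append_zero (x : ℤ → S) (y : S) : append x y 0 = y := if_neg (lt_irrefl 0)

lemma comp_truncFuture {β : Type*} {f : (ℤ → S) → β} (hf : DependsOn f (Set.Iic 0))
    (x : ℤ → S) : f (truncFuture x) = f x :=
  hf fun k hk => by simp [truncFuture, min_eq_left (Set.mem_Iic.1 hk)]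

variable [MeasurableSpace S]

lemma measurable_append : Measurable (fun p : (ℤ → S) × S => append p.1 p.2) := by
  refine measurable_pi_lambda _ fun k => ?_
  by_cases hk : k < 0
  · simp only [append, hk, if_true]; fun_prop
  · simp only [append, hk, if_false]; fun_prop

lemma measurable_truncFuture : Measurable (truncFuture : (ℤ → S) → ℤ → S) :=
  measurable_pi_lambda _ fun _ => measurable_pi_apply _

/-- A bounded measurable real function of the past. -/
structure IsBddPast (f : (ℤ → S) → ℝ) (c : ℝ) : Prop where
  measurable : Measurable f
  abs_le : ∀ x, |f x| ≤ c
  dependsOn : DependsOn f (Set.Iic (0 : ℤ))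

lemma IsBddPast.integrable {f : (ℤ → S) → ℝ} {c : ℝ} (hf : IsBddPast f c)
    (P : Measure (ℤ → S)) [IsProbabilityMeasure P] : Integrable f P :=
  Integrable.of_bound hf.measurable.aestronglyMeasurable c (.of_forall hf.abs_le)

lemma IsBddPast.integrable_append {f : (ℤ → S) → ℝ} {c : ℝ} (hf : IsBddPast f c)
    (ν : Measure S) [IsProbabilityMeasure ν] (x : ℤ → S) :
    Integrable (fun y => f (append x y)) ν :=
  Integrable.of_bound (hf.measurable.comp
    (measurable_append.comp measurable_prodMk_left)).aestronglyMeasurable c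
    (.of_forall fun _ => hf.abs_le _)

lemma abs_integral_le_of_abs_le {Ω : Type*} [MeasurableSpace Ω] (ν : Measure Ω)
    [IsProbabilityMeasure ν] {g : Ω → ℝ} {δ : ℝ} (h : ∀ y, |g y| ≤ δ) : |∫ y, g y ∂ν| ≤ δ := by
  simpa using norm_integral_le_of_norm_le_const (μ := ν) (f := g) (C := δ) (.of_forall h)

/-- The transition operator of the Markov chain of pasts: from the past `x`, the chain moves to
`append x y` with `y` of law `K (x 0)`. -/
noncomputable def pastOp (K : Kernel S S) (f : (ℤ → S) → ℝ) (x : ℤ → S) : ℝ :=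
  ∫ y, f (append x y) ∂(K (x 0))

variable (K : Kernel S S) [IsMarkovKernel K]

lemma abs_pastOp_sub_le {f g : (ℤ → S) → ℝ} {c d δ : ℝ} (hf : IsBddPast f c) (hg : IsBddPast g d)
    {x x' : ℤ → S} (h0 : x 0 = x' 0) (h : ∀ y, |f (append x y) - g (append x' y)| ≤ δ) :
    |pastOp K f x - pastOp K g x'| ≤ δ := by
  rw [pastOp, pastOp, ← h0, ← integral_sub (hf.integrable_append _ x) (hg.integrable_append _ x')]
  exact abs_integral_le_of_abs_le _ h

lemma IsBddPast.zero : IsBddPast (fun _ : ℤ → S => 0) 0 :=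
  ⟨measurable_const, by simp, fun _ _ _ => rfl⟩

lemma IsBddPast.pastOp {f : (ℤ → S) → ℝ} {c : ℝ} (hf : IsBddPast f c) :
    IsBddPast (pastOp K f) c where
  measurable := by
    have h : StronglyMeasurable (fun p : (ℤ → S) × S => f (append p.1 p.2)) :=
      (hf.measurable.comp measurable_append).stronglyMeasurable
    exact (h.integral_kernel_prod_right'
      (κ := K.comap (fun x : ℤ → S => x 0) (measurable_pi_apply 0))).measurable
  abs_le x := abs_integral_le_of_abs_le _ fun y => hf.abs_le (append x y)
  dependsOn x x' hx := by
    have h0 : x 0 = x' 0 := hx 0 (Set.mem_Iic.2 le_rfl)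
    have h : ∀ y, f (append x y) = f (append x' y) := fun y => hf.dependsOn fun k hk => by
      rcases (Set.mem_Iic.1 hk).lt_or_eq with hk' | rfl
      · rw [append_of_neg _ _ hk', append_of_neg _ _ hk']
        exact hx _ (Set.mem_Iic.2 (by omega))
      · simp
    simp only [MarkovShift.pastOp, h, h0]

lemma IsBddPast.iterate_pastOp {f : (ℤ → S) → ℝ} {c : ℝ} (hf : IsBddPast f c) (n : ℕ) :
    IsBddPast ((MarkovShift.pastOp K)^[n] f) c := by
  induction n with
  | zero => exact hf
  | succ n ih => rw [Function.iterate_succ_apply']; exact ih.pastOp K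

lemma IsBddPast.sum {ι : Type*} {f : ι → (ℤ → S) → ℝ} {c : ι → ℝ} (s : Finset ι)
    (hf : ∀ i ∈ s, IsBddPast (f i) (c i)) :
    IsBddPast (fun x => ∑ i ∈ s, f i x) (∑ i ∈ s, c i) where
  measurable := Finset.measurable_fun_sum s fun i hi => (hf i hi).measurable
  abs_le x := (Finset.abs_sum_le_sum_abs _ _).trans
    (Finset.sum_le_sum fun i hi => (hf i hi).abs_le x)
  dependsOn _ _ h := Finset.sum_congr rfl fun i hi => (hf i hi).dependsOn h

/-- If `f` oscillates by at most `δ` on sequences with the same coordinates in `[-n, 0]`, then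
`n` transitions turn it into a function that is within `δ` of a function of `x 0`, since the
appended coordinates push the old past out of the window `[-n, 0]`. -/
lemma abs_iterate_pastOp_sub_le {f : (ℤ → S) → ℝ} {c δ : ℝ} (n : ℕ) (hf : IsBddPast f c)
    (hδ : ∀ x x' : ℤ → S, (∀ k : ℤ, -(n : ℤ) ≤ k → k ≤ 0 → x k = x' k) → |f x - f x'| ≤ δ)
    {x x' : ℤ → S} (h0 : x 0 = x' 0) :
    |(pastOp K)^[n] f x - (pastOp K)^[n] f x'| ≤ δ := by
  induction n generalizing f x x' with
  | zero =>
    refine hδ x x' fun k hk hk' => ?_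
    obtain rfl : k = 0 := by simp at hk; omega
    exact h0
  | succ n ih =>
    rw [Function.iterate_succ_apply]
    refine ih (hf.pastOp K) (fun z z' hz => ?_) h0
    refine abs_pastOp_sub_le K hf hf (hz 0 (by omega) le_rfl) fun y => hδ _ _ fun k hk hk' => ?_
    rcases hk'.lt_or_eq with hk'' | rfl
    · rw [append_of_neg _ _ hk'', append_of_neg _ _ hk'']
      exact hz _ (by push_cast at hk; omega) (by omega)
    · simp

lemma iterate_pastOp_sub_le {f g : (ℤ → S) → ℝ} {c d δ : ℝ} (n : ℕ) (hf : IsBddPast f c)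
    (hg : IsBddPast g d) (h : ∀ x, |f x - g x| ≤ δ) (x : ℤ → S) :
    |(pastOp K)^[n] f x - (pastOp K)^[n] g x| ≤ δ := by
  induction n generalizing f g with
  | zero => exact h x
  | succ n ih =>
    exact ih (hf.pastOp K) (hg.pastOp K) fun x => abs_pastOp_sub_le K hf hg rfl fun y => h _

lemma isBddPast_comp_zero {φ : S → ℝ} {c : ℝ} (hφ : Measurable φ) (hc : ∀ s, |φ s| ≤ c) :
    IsBddPast (fun x : ℤ → S => φ (x 0)) c :=
  ⟨hφ.comp (measurable_pi_apply 0), fun _ => hc _,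
    fun _ _ h => congrArg φ (h 0 (Set.mem_Iic.2 le_rfl))⟩

/-- On functions of the present, the chain of pasts moves like the chain of `K`. -/
lemma iterate_pastOp_comp_zero {φ : S → ℝ} {c : ℝ} (hφ : Measurable φ) (hc : ∀ s, |φ s| ≤ c)
    (n : ℕ) (x : ℤ → S) :
    (pastOp K)^[n] (fun x => φ (x 0)) x = ∫ s, φ s ∂((K ^ n) (x 0)) := by
  have hK : ∀ n : ℕ, IsMarkovKernel (K ^ n) := fun n => by
    induction n with
    | zero => rw [pow_zero]; exact inferInstanceAs (IsMarkovKernel (Kernel.id : Kernel S S))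
    | succ n ih =>
      rw [pow_succ]; exact inferInstanceAs (IsMarkovKernel ((K ^ n) ∘ₖ K))
  induction n generalizing φ with
  | zero =>
    rw [pow_zero]
    change φ (x 0) = ∫ s, φ s ∂((Kernel.id : Kernel S S) (x 0))
    rw [Kernel.id_apply, integral_dirac' _ _ hφ.stronglyMeasurable]
  | succ n ih =>
    have e : pastOp K (fun x : ℤ → S => φ (x 0)) =
        fun x => (fun s => ∫ t, φ t ∂(K s)) (x 0) := by
      funext x; simp [pastOp]
    rw [Function.iterate_succ_apply, e, ih (φ := fun s => ∫ t, φ t ∂(K s))]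
    · have hi : Integrable φ ((K ∘ₖ (K ^ n)) (x 0)) :=
        Integrable.of_bound hφ.aestronglyMeasurable c (.of_forall hc)
      rw [pow_succ']
      exact (Kernel.integral_comp hi).symm
    · exact (hφ.stronglyMeasurable.comp_measurable
        measurable_snd).integral_kernel_prod_right'.measurable
    · exact fun s => abs_integral_le_of_abs_le _ hc

/-- Geometric loss of memory of the chain of pasts. Of the `a + b` transitions, `b` are spent on
making `f` almost a function of the present, and `a` on the mixing of `K`. -/
lemma abs_iterate_pastOp_sub_le_of_mixing {f : (ℤ → S) → ℝ} {c δ η : ℝ} (a b : ℕ)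
    (hf : IsBddPast f c)
    (hδ : ∀ x x' : ℤ → S, (∀ k : ℤ, -(b : ℤ) ≤ k → k ≤ 0 → x k = x' k) → |f x - f x'| ≤ δ)
    (hη : ∀ φ : S → ℝ, Measurable φ → (∀ s, |φ s| ≤ c) → ∀ s s' : S,
      |(∫ t, φ t ∂((K ^ a) s)) - ∫ t, φ t ∂((K ^ a) s')| ≤ η)
    (x x' : ℤ → S) :
    |(pastOp K)^[a + b] f x - (pastOp K)^[a + b] f x'| ≤ 2 * δ + η := by
  set g := (pastOp K)^[b] f with hg
  have hgp : IsBddPast g c := hf.iterate_pastOp K b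
  let φ : S → ℝ := fun s => g fun _ => s
  have hφ : Measurable φ := hgp.measurable.comp (measurable_pi_lambda _ fun _ => measurable_id)
  have hc : ∀ s, |φ s| ≤ c := fun s => hgp.abs_le _
  have hgφ : ∀ x, |g x - φ (x 0)| ≤ δ := fun x => abs_iterate_pastOp_sub_le K b hf hδ rfl
  have h1 := fun x => iterate_pastOp_sub_le K a hgp (isBddPast_comp_zero hφ hc) hgφ x
  simp only [iterate_pastOp_comp_zero K hφ hc] at h1
  rw [Function.iterate_add_apply, ← hg]
  have h2 := abs_le.1 (h1 x)
  have h3 := abs_le.1 (h1 x')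
  have h4 := abs_le.1 (hη φ hφ hc (x 0) (x' 0))
  exact abs_le.2 ⟨by linarith, by linarith⟩

end PastChain

/-! ### Stationarity of the law of the past -/

section Stationarity

variable {S : Type*} [MeasurableSpace S] (K : Kernel S S) [IsMarkovKernel K]
  {P : Measure (ℤ → S)} [IsProbabilityMeasure P]

/-- Under a shift-invariant measure that projects to the law of a Markov chain, the law of the past
is stationary for the chain of pasts. -/
lemma map_truncFuture_eq {θ : Measure S} [IsProbabilityMeasure θ] (hT : P.map shift = P)
    (hP : P.map projPlus = pathMeasurePlus K θ) :
    P.map truncFuture = (P ⊗ₘ K.comap (fun x : ℤ → S => x 0) (measurable_pi_apply 0)).map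
      (fun p => append p.1 p.2) := by
  set κ := K.comap (fun x : ℤ → S => x 0) (measurable_pi_apply 0) with hκ
  have : IsProbabilityMeasure (P.map truncFuture) :=
    Measure.isProbabilityMeasure_map measurable_truncFuture.aemeasurable
  have : IsProbabilityMeasure ((P ⊗ₘ κ).map (fun p => append p.1 p.2)) :=
    Measure.isProbabilityMeasure_map measurable_append.aemeasurable
  have hpath : ∀ n, P.map (projFrom n) = pathMeasurePlus K θ := fun n => by
    rw [projFrom_of_invariant hT, hP]
  -- Only windows that start at a negative coordinate matter; they contain the last transition.
  have key : ∀ n : ℕ, (P.map truncFuture).map (projFrom (n + 1)) =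
      ((P ⊗ₘ κ).map (fun p => append p.1 p.2)).map (projFrom (n + 1)) := by
    intro n
    let g : ((i : Finset.Iic n) → (fun _ : ℕ => S) i) × S → (ℕ → S) :=
      fun p k => if h : k ≤ n then p.1 ⟨k, Finset.mem_Iic.2 h⟩ else p.2
    have hg : Measurable g := by
      refine measurable_pi_lambda _ fun k => ?_
      by_cases h : k ≤ n
      · simp only [g, h, dif_pos]; fun_prop
      · simp only [g, h, dif_neg, not_false_eq_true]; fun_prop
    let r : (ℤ → S) → ((i : Finset.Iic n) → (fun _ : ℕ => S) i) :=
      fun x => Preorder.frestrictLe (π := fun _ : ℕ => S) n (projFrom n x)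
    have hr : Measurable r := (by fun_prop : Measurable
      (Preorder.frestrictLe (π := fun _ : ℕ => S) n)).comp (measurable_projFrom n)
    have e1 : projFrom (n + 1) ∘ truncFuture = g ∘ (fun z : ℕ → S =>
        (Preorder.frestrictLe (π := fun _ : ℕ => S) n z, z (n + 1))) ∘ projFrom (n + 1) := by
      funext x k
      by_cases h : k ≤ n
      · simp only [projFrom, truncFuture, g, Function.comp, h, dif_pos,
          Preorder.frestrictLe_apply]
        congr 1
        omega
      · simp only [projFrom, truncFuture, g, Function.comp, h, dif_neg, not_false_eq_true]
        congr 1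
        push_cast
        omega
    have e2 : projFrom (n + 1) ∘ (fun p : (ℤ → S) × S => append p.1 p.2) =
        g ∘ Prod.map r id := by
      funext p k
      by_cases h : k ≤ n
      · have hk : (k : ℤ) - ((n + 1 : ℕ) : ℤ) < 0 := by omega
        have hk' : (k : ℤ) - ((n + 1 : ℕ) : ℤ) + 1 = k - n := by push_cast; ring
        simp only [projFrom, Function.comp, append_of_neg _ _ hk, g, h, dif_pos, Prod.map, r,
          Preorder.frestrictLe_apply, hk']
      · have hk : ¬ (k : ℤ) - ((n + 1 : ℕ) : ℤ) < 0 := by omega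
        simp only [projFrom, append, Function.comp, hk, g, h, if_false, dif_neg,
          not_false_eq_true, Prod.map, id]
    rw [Measure.map_map (measurable_projFrom _) measurable_truncFuture, e1,
      Measure.map_map (measurable_projFrom _) measurable_append, e2,
      ← Function.comp_assoc, ← Measure.map_map (hg.comp (by fun_prop)) (measurable_projFrom _),
      hpath, ← Measure.map_map hg (by fun_prop), ← pathMeasurePlus_step, ← hpath n,
      Measure.map_map (by fun_prop) (measurable_projFrom n),
      ← Measure.map_map hg (by fun_prop)]
    congr 1
    have : IsProbabilityMeasure (P.map r) := Measure.isProbabilityMeasure_map hr.aemeasurable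
    change P.map r ⊗ₘ stepKernel K n = _
    ext A hA
    have hm : Measurable (Prod.map r (id : S → S)) := by fun_prop
    rw [Measure.compProd_apply hA, Measure.map_apply hm hA, Measure.compProd_apply (hm hA),
      lintegral_map (Kernel.measurable_kernel_prodMk_left hA) hr]
    refine lintegral_congr fun x => ?_
    have hx : r x ⟨n, Finset.mem_Iic.2 le_rfl⟩ = x 0 := by simp [r, projFrom]
    simp only [stepKernel, Kernel.comap_apply, hκ, hx]
    rfl
  refine eq_of_projFrom fun n => ?_
  have e : (projFrom n : (ℤ → S) → ℕ → S) = shiftPlus ∘ projFrom (n + 1) := by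
    funext x k
    simp only [projFrom, shiftPlus, Function.comp]
    congr 1
    push_cast
    ring
  rw [e, ← Measure.map_map measurable_shiftPlus (measurable_projFrom _), key,
    Measure.map_map measurable_shiftPlus (measurable_projFrom _)]

/-- The stationarity of the law of the past, in terms of functions. -/
lemma integral_pastOp {θ : Measure S} [IsProbabilityMeasure θ] (hT : P.map shift = P)
    (hP : P.map projPlus = pathMeasurePlus K θ) {f : (ℤ → S) → ℝ} {c : ℝ} (hf : IsBddPast f c) :
    ∫ x, pastOp K f x ∂P = ∫ x, f x ∂P := by
  have h1 : ∫ x, f x ∂P = ∫ x, f x ∂(P.map truncFuture) := by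
    rw [integral_map measurable_truncFuture.aemeasurable hf.measurable.aestronglyMeasurable]
    simp only [comp_truncFuture hf.dependsOn]
  rw [h1, map_truncFuture_eq K hT hP, integral_map measurable_append.aemeasurable
    hf.measurable.aestronglyMeasurable, Measure.integral_compProd]
  · rfl
  · exact Integrable.of_bound (hf.measurable.comp measurable_append).aestronglyMeasurable c
      (.of_forall fun _ => hf.abs_le _)

end Stationarity

/-! ### Exponential moments of orbit sums -/

section Exponential

variable {S : Type*}

/-- The sequence `x` with the origin moved `j` steps to the left. -/
def shiftBack (j : ℕ) (x : ℤ → S) : ℤ → S := fun k => x (k - j)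

/-- The sum of `f` over the `n` sequences that precede `x` along its orbit under the shift. -/
noncomputable def backwardSum (f : (ℤ → S) → ℝ) (n : ℕ) (x : ℤ → S) : ℝ :=
  ∑ j ∈ Finset.range n, f (shiftBack (j + 1) x)

lemma backwardSum_succ_append {f : (ℤ → S) → ℝ} (hf : DependsOn f (Set.Iic (0 : ℤ))) (n : ℕ)
    (x : ℤ → S) (y : S) :
    backwardSum f (n + 1) (append x y) = backwardSum f n x + f x := by
  have h : ∀ j : ℕ, f (shiftBack (j + 1) (append x y)) = f (shiftBack j x) := fun j =>
    hf fun k hk => by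
      have hk0 : k ≤ 0 := hk
      have h1 : k - ((j + 1 : ℕ) : ℤ) < 0 := by omega
      rw [shiftBack, append_of_neg _ _ h1, shiftBack]
      congr 1
      push_cast
      ring
  have h0 : shiftBack 0 x = x := by funext k; simp [shiftBack]
  simp only [backwardSum, h]
  rw [Finset.sum_range_succ', h0]

lemma backwardSum_iterate_shift (f : (ℤ → S) → ℝ) (n : ℕ) (x : ℤ → S) :
    backwardSum f n (shift^[n] x) = ∑ j ∈ Finset.range n, f (shift^[j] x) := by
  rw [backwardSum, ← Finset.sum_range_reflect]
  refine Finset.sum_congr rfl fun j hj => congrArg f ?_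
  have := Finset.mem_range.1 hj
  funext k
  simp only [shiftBack, iterate_shift_apply]
  congr 1
  omega

variable [MeasurableSpace S]

lemma measurable_shiftBack (j : ℕ) : Measurable (shiftBack j : (ℤ → S) → ℤ → S) :=
  measurable_pi_lambda _ fun _ => measurable_pi_apply _

lemma IsBddPast.comp_shiftBack {f : (ℤ → S) → ℝ} {c : ℝ} (hf : IsBddPast f c) (j : ℕ) :
    IsBddPast (fun x => f (shiftBack j x)) c where
  measurable := hf.measurable.comp (measurable_shiftBack j)
  abs_le _ := hf.abs_le _
  dependsOn _ _ h := hf.dependsOn fun k hk => h _ (by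
    have : k ≤ 0 := hk
    exact Set.mem_Iic.2 (by omega))

lemma IsBddPast.backwardSum {f : (ℤ → S) → ℝ} {c : ℝ} (hf : IsBddPast f c) (n : ℕ) :
    IsBddPast (MarkovShift.backwardSum f n) (∑ _j ∈ Finset.range n, c) :=
  IsBddPast.sum _ fun j _ => hf.comp_shiftBack (j + 1)

lemma IsBddPast.exp_mul_add {f g : (ℤ → S) → ℝ} {c d : ℝ} (hf : IsBddPast f c)
    (hg : IsBddPast g d) (t : ℝ) :
    IsBddPast (fun x => Real.exp (t * f x + t * g x)) (Real.exp (|t| * c + |t| * d)) where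
  measurable := ((hf.measurable.const_mul t).add (hg.measurable.const_mul t)).exp
  abs_le x := by
    rw [Real.abs_exp]
    refine Real.exp_le_exp.2 (add_le_add ?_ ?_) <;>
    refine (le_abs_self _).trans ?_ <;> rw [abs_mul]
    · exact mul_le_mul_of_nonneg_left (hf.abs_le x) (abs_nonneg t)
    · exact mul_le_mul_of_nonneg_left (hg.abs_le x) (abs_nonneg t)
  dependsOn x y h := by simp only [hf.dependsOn h, hg.dependsOn h]

/-- Hoeffding's lemma for a variable with values in `[-M, M]`, not assumed to be centered. -/
lemma integral_exp_mul_le {Ω : Type*} [MeasurableSpace Ω] (ν : Measure Ω)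
    [IsProbabilityMeasure ν] {g : Ω → ℝ} (hg : Measurable g) {M : ℝ} (hM : ∀ y, |g y| ≤ M)
    (t : ℝ) :
    ∫ y, Real.exp (t * g y) ∂ν ≤ Real.exp (t * ∫ y, g y ∂ν + M ^ 2 * t ^ 2 / 2) := by
  have h := (hasSubgaussianMGF_of_mem_Icc (μ := ν) (a := -M) (b := M) hg.aemeasurable
    (.of_forall fun y => Set.mem_Icc.2 (abs_le.1 (hM y)))).mgf_le t
  have hc : (((‖M - -M‖₊ / 2) ^ 2 : NNReal) : ℝ) = M ^ 2 := by
    have : M - -M = 2 * M := by ring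
    simp [this]
  rw [hc] at h
  have e : ∀ y, Real.exp (t * g y) =
      Real.exp (t * ∫ y, g y ∂ν) * Real.exp (t * (g y - ∫ y, g y ∂ν)) := fun y => by
    rw [← Real.exp_add]; ring_nf
  simp_rw [e]
  rw [integral_const_mul, Real.exp_add]
  exact mul_le_mul_of_nonneg_left h (Real.exp_pos _).le

variable (K : Kernel S S) [IsMarkovKernel K]

/-- The expected sum of `f` over the first `m` steps of the chain of pasts that starts at `x`. -/
noncomputable def expectedSum (f : (ℤ → S) → ℝ) (m : ℕ) (x : ℤ → S) : ℝ :=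
  ∑ j ∈ Finset.range m, (pastOp K)^[j] f x

lemma isBddPast_expectedSum {f : (ℤ → S) → ℝ} {c : ℝ} (hf : IsBddPast f c) (m : ℕ) :
    IsBddPast (expectedSum K f m) (∑ _j ∈ Finset.range m, c) :=
  IsBddPast.sum _ fun j _ => hf.iterate_pastOp K j

lemma expectedSum_succ {f : (ℤ → S) → ℝ} {c : ℝ} (hf : IsBddPast f c) (m : ℕ) (x : ℤ → S) :
    expectedSum K f (m + 1) x = f x + pastOp K (expectedSum K f m) x := by
  rw [expectedSum, Finset.sum_range_succ', add_comm]
  congr 1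
  simp only [pastOp, expectedSum]
  rw [integral_finsetSum _ fun j _ => (hf.iterate_pastOp K j).integrable_append _ x]
  refine Finset.sum_congr rfl fun j _ => ?_
  rw [Function.iterate_succ_apply']
  rfl

variable {P : Measure (ℤ → S)} [IsProbabilityMeasure P] {θ : Measure S} [IsProbabilityMeasure θ]

/-- One step of the martingale estimate: revealing one transition less replaces `expectedSum K f m`
by its conditional expectation, at the cost of the factor of Hoeffding's lemma. -/
lemma integral_exp_backwardSum_succ_le (hT : P.map shift = P)
    (hP : P.map projPlus = pathMeasurePlus K θ) {f : (ℤ → S) → ℝ} {c M : ℝ}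
    (hf : IsBddPast f c) (hM : ∀ m x, |expectedSum K f m x| ≤ M) (t : ℝ) (n m : ℕ) :
    ∫ x, Real.exp (t * backwardSum f (n + 1) x + t * expectedSum K f m x) ∂P ≤
      Real.exp (M ^ 2 * t ^ 2 / 2) *
        ∫ x, Real.exp (t * backwardSum f n x + t * expectedSum K f (m + 1) x) ∂P := by
  have hu := isBddPast_expectedSum K hf m
  have hF := (hf.backwardSum (n + 1)).exp_mul_add hu t
  have hG := (hf.backwardSum n).exp_mul_add (isBddPast_expectedSum K hf (m + 1)) t
  rw [← integral_pastOp K hT hP hF, ← integral_const_mul]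
  refine integral_mono ((hF.pastOp K).integrable P) ((hG.integrable P).const_mul _) fun x => ?_
  simp only [pastOp, backwardSum_succ_append hf.dependsOn, Real.exp_add]
  rw [integral_const_mul]
  have h := integral_exp_mul_le (K (x 0)) (g := fun y => expectedSum K f m (append x y))
    (hu.measurable.comp (measurable_append.comp measurable_prodMk_left))
    (fun y => hM m (append x y)) t
  refine (mul_le_mul_of_nonneg_left h (Real.exp_pos _).le).trans_eq ?_
  simp only [expectedSum_succ K hf, pastOp, ← Real.exp_add]
  congr 1
  ring

lemma integral_exp_backwardSum_le (hT : P.map shift = P)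
    (hP : P.map projPlus = pathMeasurePlus K θ) {f : (ℤ → S) → ℝ} {c M : ℝ}
    (hf : IsBddPast f c) (hM : ∀ m x, |expectedSum K f m x| ≤ M) {t : ℝ} (ht : 0 ≤ t) (n m : ℕ) :
    ∫ x, Real.exp (t * backwardSum f n x + t * expectedSum K f m x) ∂P ≤
      Real.exp (n * (M ^ 2 * t ^ 2 / 2) + t * M) := by
  induction n generalizing m with
  | zero =>
    simp only [backwardSum, Finset.range_zero, Finset.sum_empty, mul_zero, zero_add,
      Nat.cast_zero, zero_mul]
    refine (le_abs_self _).trans (abs_integral_le_of_abs_le P fun x => ?_)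
    rw [Real.abs_exp]
    exact Real.exp_le_exp.2 (mul_le_mul_of_nonneg_left ((le_abs_self _).trans (hM m x)) ht)
  | succ n ih =>
    refine (integral_exp_backwardSum_succ_le K hT hP hf hM t n m).trans ?_
    refine (mul_le_mul_of_nonneg_left (ih (m + 1)) (Real.exp_pos _).le).trans_eq ?_
    rw [← Real.exp_add]
    congr 1
    push_cast
    ring

/-- The one-sided deviation inequality for a function of the past whose expected sums along the
chain of pasts are bounded by `M`. -/
lemma measureReal_le_sum_shift_le (hT : P.map shift = P)
    (hP : P.map projPlus = pathMeasurePlus K θ) {f : (ℤ → S) → ℝ} {c M : ℝ} (hM0 : 0 < M)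
    (hf : IsBddPast f c) (hM : ∀ m x, |expectedSum K f m x| ≤ M) {ε : ℝ} (hε : 0 ≤ ε) (n : ℕ) :
    P.real {x | n * ε ≤ ∑ j ∈ Finset.range n, f (shift^[j] x)} ≤
      Real.exp (ε / M - ε ^ 2 * n / (2 * M ^ 2)) := by
  -- The minimizer of `-t ε n + n M² t² / 2`.
  set t := ε / M ^ 2 with ht_def
  have ht : 0 ≤ t := by positivity
  have hb := hf.backwardSum n
  have hmp : MeasurePreserving (shift^[n] : (ℤ → S) → ℤ → S) P P :=
    MeasurePreserving.iterate ⟨measurable_shift, hT⟩ n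
  have hset : P.real {x | n * ε ≤ ∑ j ∈ Finset.range n, f (shift^[j] x)} =
      P.real {x | n * ε ≤ backwardSum f n x} := by
    simp only [← backwardSum_iterate_shift]
    exact congrArg ENNReal.toReal (hmp.measure_preimage
      (measurableSet_le measurable_const hb.measurable).nullMeasurableSet)
  have hint := ((hb.exp_mul_add (IsBddPast.zero) t).integrable P)
  have hmgf := integral_exp_backwardSum_le K hT hP hf hM ht n 0
  simp only [expectedSum, Finset.range_zero, Finset.sum_empty, mul_zero, add_zero] at hint hmgf
  rw [hset]
  refine (measure_ge_le_exp_mul_mgf _ ht hint).trans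
    ((mul_le_mul_of_nonneg_left hmgf (Real.exp_pos _).le).trans_eq ?_)
  rw [← Real.exp_add, ht_def]
  congr 1
  field_simp
  ring

end Exponential

/-! ### Mixing and bounded expected sums -/

section Mixing

variable {S : Type*} [MeasurableSpace S]

lemma norm_le_of_supNorm_le {Y : Type*} {f : Y → ℂ} {c : ℝ} (hc : 0 ≤ c)
    (h : supNorm f ≤ ENNReal.ofReal c) (y : Y) : ‖f y‖ ≤ c := by
  have h1 : ‖f y‖ₑ ≤ ENNReal.ofReal c := (le_iSup (fun y => ‖f y‖ₑ) y).trans h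
  rwa [← ofReal_norm, ENNReal.ofReal_le_ofReal_iff hc] at h1

/-- Strong mixing makes the transition probabilities forget their starting point, in a form that
does not involve the stationary measure. -/
lemma StronglyMixing.exists_abs_integral_sub_le {K : Kernel S S} {μ : Measure S}
    (h : StronglyMixing K μ) :
    ∃ C > (0 : ℝ), ∃ ρ : ℝ, 0 < ρ ∧ ρ < 1 ∧ ∀ (c : ℝ), 0 ≤ c → ∀ φ : S → ℝ, Measurable φ →
      (∀ s, |φ s| ≤ c) → ∀ (a : ℕ) (s s' : S),
        |(∫ t, φ t ∂((K ^ a) s)) - ∫ t, φ t ∂((K ^ a) s')| ≤ 2 * C * c * ρ ^ a := by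
  obtain ⟨C, hC, ρ, hρ0, hρ1, h⟩ := h
  refine ⟨C, hC, ρ, hρ0, hρ1, fun c hc φ hφ hφc a s s' => ?_⟩
  have hsup : supNorm (fun s => (φ s : ℂ)) ≤ ENNReal.ofReal c := iSup_le fun s => by
    rw [← ofReal_norm, Complex.norm_real]
    exact ENNReal.ofReal_le_ofReal (hφc s)
  have hmem : MemLInfty (fun s => (φ s : ℂ)) :=
    ⟨Complex.measurable_ofReal.comp hφ, hsup.trans_lt ENNReal.ofReal_lt_top⟩
  have hsup' : (supNorm (fun s => (φ s : ℂ))).toReal ≤ c := ENNReal.toReal_le_of_le_ofReal hc hsup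
  have key : ∀ s, |(∫ t, φ t ∂((K ^ a) s)) - ∫ t, φ t ∂μ| ≤ C * ρ ^ a * c := fun s => by
    have h1 := h _ hmem s a
    rw [integral_complex_ofReal, integral_complex_ofReal, ← Complex.ofReal_sub, Complex.norm_real] at h1
    exact h1.trans (mul_le_mul_of_nonneg_left hsup' (by positivity))
  have h1 := abs_le.1 (key s)
  have h2 := abs_le.1 (key s')
  exact abs_le.2 ⟨by linarith, by linarith⟩

lemma sum_pow_half_le {r : ℝ} (hr0 : 0 ≤ r) (hr1 : r < 1) (m : ℕ) :
    ∑ j ∈ Finset.range m, r ^ (j / 2) ≤ 2 / (1 - r) := by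
  have h : ∀ m : ℕ, ∑ j ∈ Finset.range (2 * m), r ^ (j / 2) = 2 * ∑ i ∈ Finset.range m, r ^ i := by
    intro m
    induction m with
    | zero => simp
    | succ m ih =>
      have h1 : (2 * m + 1) / 2 = m := by omega
      have h2 : 2 * m / 2 = m := by omega
      rw [show 2 * (m + 1) = 2 * m + 1 + 1 by ring, Finset.sum_range_succ, Finset.sum_range_succ,
        ih, h1, h2, Finset.sum_range_succ]
      ring
  have hg : ∑ i ∈ Finset.range m, r ^ i ≤ (1 - r)⁻¹ := by
    rw [← tsum_geometric_of_lt_one hr0 hr1]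
    exact (summable_geometric_of_lt_one hr0 hr1).sum_le_tsum _ fun i _ => pow_nonneg hr0 i
  calc ∑ j ∈ Finset.range m, r ^ (j / 2) ≤ ∑ j ∈ Finset.range (2 * m), r ^ (j / 2) :=
        Finset.sum_le_sum_of_subset_of_nonneg
          (Finset.range_subset_range.2 (by omega)) fun i _ _ => pow_nonneg hr0 _
    _ ≤ 2 / (1 - r) := by
        rw [h, div_eq_mul_inv]
        exact mul_le_mul_of_nonneg_left hg zero_le_two

/-- The expected sums of a centered function of the past are bounded, uniformly in the number of
steps, when its oscillation decays geometrically and `K` mixes geometrically. -/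
lemma abs_expectedSum_le (K : Kernel S S) [IsMarkovKernel K] {P : Measure (ℤ → S)}
    [IsProbabilityMeasure P] {θ : Measure S} [IsProbabilityMeasure θ] (hT : P.map shift = P)
    (hP : P.map projPlus = pathMeasurePlus K θ) {f : (ℤ → S) → ℝ} {c D E r : ℝ}
    (hf : IsBddPast f c) (hf0 : ∫ x, f x ∂P = 0) (hE : 0 ≤ E) (hr0 : 0 ≤ r) (hr1 : r < 1)
    (hD : ∀ (b : ℕ) (x x' : ℤ → S), (∀ k : ℤ, -(b : ℤ) ≤ k → k ≤ 0 → x k = x' k) →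
      |f x - f x'| ≤ D * r ^ b)
    (hmix : ∀ φ : S → ℝ, Measurable φ → (∀ s, |φ s| ≤ c) → ∀ (a : ℕ) (s s' : S),
      |(∫ t, φ t ∂((K ^ a) s)) - ∫ t, φ t ∂((K ^ a) s')| ≤ E * r ^ a) (m : ℕ) (x : ℤ → S) :
    |expectedSum K f m x| ≤ (2 * D + E) * (2 / (1 - r)) := by
  have hD0 : 0 ≤ D := by simpa using hD 0 x x fun _ _ _ => rfl
  have hosc : ∀ (j : ℕ) (x x' : ℤ → S),
      |(pastOp K)^[j] f x - (pastOp K)^[j] f x'| ≤ (2 * D + E) * r ^ (j / 2) := by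
    intro j x x'
    have h := abs_iterate_pastOp_sub_le_of_mixing K (j - j / 2) (j / 2) hf (hD (j / 2))
      (fun φ h1 h2 => hmix φ h1 h2 (j - j / 2)) x x'
    rw [Nat.sub_add_cancel (Nat.div_le_self j 2)] at h
    have h1 : r ^ (j - j / 2) ≤ r ^ (j / 2) := pow_le_pow_of_le_one hr0 hr1.le (by omega)
    have h2 := mul_le_mul_of_nonneg_left h1 hE
    linarith
  have hint : ∀ j, ∫ x, (pastOp K)^[j] f x ∂P = 0 := by
    intro j
    induction j with
    | zero => exact hf0
    | succ j ih =>
      rw [Function.iterate_succ_apply', integral_pastOp K hT hP (hf.iterate_pastOp K j), ih]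
  have hb : ∀ (j : ℕ) (x : ℤ → S), |(pastOp K)^[j] f x| ≤ (2 * D + E) * r ^ (j / 2) := by
    intro j x
    have e : (pastOp K)^[j] f x = ∫ x', ((pastOp K)^[j] f x - (pastOp K)^[j] f x') ∂P := by
      rw [integral_sub (integrable_const _) ((hf.iterate_pastOp K j).integrable P), hint]
      simp
    rw [e]
    exact abs_integral_le_of_abs_le P fun x' => hosc j x x'
  refine (Finset.abs_sum_le_sum_abs _ _).trans ((Finset.sum_le_sum fun j _ => hb j x).trans ?_)
  rw [← Finset.mul_sum]
  exact mul_le_mul_of_nonneg_left (sum_pow_half_le hr0 hr1 m) (by positivity)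

end Mixing

/-! ### Oscillation of Hölder observables -/

section Oscillation

variable {S : Type*}

lemma dTilde_le_of_eqOn {x x' : ℤ → S} {b : ℕ} (h : ∀ k : ℤ, -(b : ℤ) ≤ k → k ≤ b → x k = x' k) :
    dTilde x x' ≤ ((2 : ℝ) ^ b)⁻¹ := by
  unfold dTilde
  split_ifs with hx
  · positivity
  · obtain ⟨k, hk⟩ := Function.ne_iff.1 hx
    obtain ⟨k', hk', hm⟩ := Nat.sInf_mem (s := {m : ℕ | ∃ k : ℤ, x k ≠ x' k ∧ m = k.natAbs})
      ⟨_, k, hk, rfl⟩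
    rw [hm]
    refine inv_anti₀ (by positivity) (pow_le_pow_right₀ one_le_two ?_)
    by_contra hlt
    exact hk' (h k' (by omega) (by omega))

lemma norm_sub_le_of_holderNorm_le {α L : ℝ} (hL : 0 ≤ L) {ξ : (ℤ → S) → ℂ}
    (hξ : FutureIndependent ξ) (h : holderNorm α ξ ≤ ENNReal.ofReal L) {b : ℕ} {x x' : ℤ → S}
    (hx : ∀ k : ℤ, -(b : ℤ) ≤ k → k ≤ 0 → x k = x' k) :
    ‖ξ x - ξ x'‖ ≤ L * ((2 : ℝ) ^ (-α)) ^ b := by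
  -- The future of `x'` can be replaced by that of `x`, which makes the two sequences close.
  let z : ℤ → S := fun k => if k ≤ 0 then x' k else x k
  have hz : ξ x' = ξ z := hξ _ _ fun k hk => by simp [z, hk]
  have hd : dTilde x z ≤ ((2 : ℝ) ^ b)⁻¹ := dTilde_le_of_eqOn fun k hk _ => by
    by_cases hk0 : k ≤ 0
    · simp [z, hk0, hx k hk hk0]
    · simp [z, hk0]
  have h1 : ‖ξ x - ξ z‖ₑ ≤ oscAt b ξ :=
    le_iSup_of_le x (le_iSup_of_le z (le_iSup_of_le hd le_rfl))
  have h2 : ENNReal.ofReal ((2 : ℝ) ^ (α * b)) * ‖ξ x - ξ z‖ₑ ≤ ENNReal.ofReal L :=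
    (mul_le_mul_right h1 _).trans ((le_iSup
      (fun k : ℕ => ENNReal.ofReal ((2 : ℝ) ^ (α * k)) * oscAt k ξ) b).trans
      (le_add_self.trans h))
  rw [← ofReal_norm, ← ENNReal.ofReal_mul (by positivity), ENNReal.ofReal_le_ofReal_iff hL] at h2
  have e : ((2 : ℝ) ^ (-α)) ^ b = ((2 : ℝ) ^ (α * b))⁻¹ := by
    rw [← Real.rpow_natCast, ← Real.rpow_mul zero_le_two, neg_mul, Real.rpow_neg zero_le_two]
  rw [hz, e, ← div_eq_mul_inv, le_div_iff₀ (by positivity), mul_comm]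
  exact h2

end Oscillation

/-! ### Deviation inequalities -/

section Deviation

variable {S : Type*} [MeasurableSpace S]

/-- The one-sided deviation inequality for the image of a complex Hölder observable of the past
under a contractive real-linear functional, such as `± re` and `± im`. -/
lemma measureReal_clm_sum_shift_le (K : Kernel S S) [IsMarkovKernel K] {P : Measure (ℤ → S)}
    [IsProbabilityMeasure P] {θ : Measure S} [IsProbabilityMeasure θ] (hT : P.map shift = P)
    (hP : P.map projPlus = pathMeasurePlus K θ) {L C r : ℝ} (hL : 0 < L) (hC : 0 < C)
    (hr0 : 0 ≤ r) (hr1 : r < 1)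
    (hmix : ∀ (c : ℝ), 0 ≤ c → ∀ φ : S → ℝ, Measurable φ → (∀ s, |φ s| ≤ c) →
      ∀ (a : ℕ) (s s' : S),
        |(∫ t, φ t ∂((K ^ a) s)) - ∫ t, φ t ∂((K ^ a) s')| ≤ 2 * C * c * r ^ a)
    {ξ : (ℤ → S) → ℂ} (hξm : Measurable ξ) (hξ : FutureIndependent ξ) (hξL : ∀ x, ‖ξ x‖ ≤ L)
    (hosc : ∀ (b : ℕ) (x x' : ℤ → S), (∀ k : ℤ, -(b : ℤ) ≤ k → k ≤ 0 → x k = x' k) →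
      ‖ξ x - ξ x'‖ ≤ L * r ^ b)
    {ℓ : ℂ →L[ℝ] ℝ} (hℓ : ∀ z, |ℓ z| ≤ ‖z‖) {M : ℝ}
    (hM : M = (2 * L + 2 * C * (2 * L)) * (2 / (1 - r))) {ε : ℝ} (hε : 0 ≤ ε) (n : ℕ) :
    P.real {x | n * ε ≤ ∑ j ∈ Finset.range n, ℓ (ξ (shift^[j] x) - ∫ y, ξ y ∂P)} ≤
      Real.exp (ε / M - ε ^ 2 * n / (2 * M ^ 2)) := by
  have hξi : Integrable ξ P := Integrable.of_bound hξm.aestronglyMeasurable L (.of_forall hξL)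
  have hmean : ‖∫ y, ξ y ∂P‖ ≤ L := by
    simpa using norm_integral_le_of_norm_le_const (μ := P) (.of_forall hξL)
  have hf : IsBddPast (fun x => ℓ (ξ x - ∫ y, ξ y ∂P)) (2 * L) :=
    ⟨ℓ.continuous.measurable.comp (hξm.sub_const _),
      fun x => (hℓ _).trans ((norm_sub_le _ _).trans (by linarith [hξL x])),
      fun x x' h => by simp only [hξ x x' fun k hk => h k (Set.mem_Iic.2 hk)]⟩
  have hf0 : ∫ x, ℓ (ξ x - ∫ y, ξ y ∂P) ∂P = 0 := by
    have e := ℓ.integral_comp_comm (hξi.sub (integrable_const (∫ y, ξ y ∂P)))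
    simp only [Pi.sub_apply] at e
    rw [e, integral_sub hξi (integrable_const _)]
    simp
  have hr : 0 < 1 - r := by linarith
  have hM0 : 0 < M := by rw [hM]; positivity
  refine measureReal_le_sum_shift_le K hT hP hM0 hf (fun m x => ?_) hε n
  rw [hM]
  refine abs_expectedSum_le K hT hP hf hf0 (by positivity) hr0 hr1 (fun b x x' h => ?_)
    (hmix (2 * L) (by positivity)) m x
  rw [← map_sub, sub_sub_sub_cancel_right]
  exact (hℓ _).trans (hosc b x x' h)

lemma exists_clm_ge_of_lt_norm {z : ℂ} {ε : ℝ} (h : ε < ‖z‖) :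
    ∃ ℓ ∈ [Complex.reCLM, -Complex.reCLM, Complex.imCLM, -Complex.imCLM], ε / 2 ≤ ℓ z := by
  by_contra! hc
  simp only [List.mem_cons, List.not_mem_nil, or_false, forall_eq_or_imp, forall_eq,
    neg_apply, Complex.reCLM_apply, Complex.imCLM_apply] at hc
  obtain ⟨h1, h2, h3, h4⟩ := hc
  have h5 := Complex.norm_le_abs_re_add_abs_im z
  have h6 : |z.re| < ε / 2 := abs_lt.2 ⟨by linarith, h1⟩
  have h7 : |z.im| < ε / 2 := abs_lt.2 ⟨by linarith, h3⟩
  linarith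

/-- The two-sided deviation inequality for complex observables: a complex deviation of size `ε`
forces a deviation of size `ε / 2` of the real or the imaginary part, in one of the two signs. -/
lemma measureReal_norm_average_le (K : Kernel S S) [IsMarkovKernel K] {P : Measure (ℤ → S)}
    [IsProbabilityMeasure P] {θ : Measure S} [IsProbabilityMeasure θ] (hT : P.map shift = P)
    (hP : P.map projPlus = pathMeasurePlus K θ) {L C r : ℝ} (hL : 0 < L) (hC : 0 < C)
    (hr0 : 0 ≤ r) (hr1 : r < 1)
    (hmix : ∀ (c : ℝ), 0 ≤ c → ∀ φ : S → ℝ, Measurable φ → (∀ s, |φ s| ≤ c) →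
      ∀ (a : ℕ) (s s' : S),
        |(∫ t, φ t ∂((K ^ a) s)) - ∫ t, φ t ∂((K ^ a) s')| ≤ 2 * C * c * r ^ a)
    {ξ : (ℤ → S) → ℂ} (hξm : Measurable ξ) (hξ : FutureIndependent ξ) (hξL : ∀ x, ‖ξ x‖ ≤ L)
    (hosc : ∀ (b : ℕ) (x x' : ℤ → S), (∀ k : ℤ, -(b : ℤ) ≤ k → k ≤ 0 → x k = x' k) →
      ‖ξ x - ξ x'‖ ≤ L * r ^ b)
    {M : ℝ} (hM : M = (2 * L + 2 * C * (2 * L)) * (2 / (1 - r))) {ε : ℝ} (hε : 0 ≤ ε) {n : ℕ}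
    (hn : 1 ≤ n) :
    P.real {x | ε < ‖(1 / (n : ℂ)) * ∑ j ∈ Finset.range n, ξ (shift^[j] x) - ∫ y, ξ y ∂P‖} ≤
      4 * Real.exp (ε / 2 / M - (ε / 2) ^ 2 * n / (2 * M ^ 2)) := by
  let A : (ℂ →L[ℝ] ℝ) → Set (ℤ → S) := fun ℓ =>
    {x | n * (ε / 2) ≤ ∑ j ∈ Finset.range n, ℓ (ξ (shift^[j] x) - ∫ y, ξ y ∂P)}
  have hn0 : (n : ℂ) ≠ 0 := by exact_mod_cast (by omega : n ≠ 0)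
  have hA : ∀ ℓ : ℂ →L[ℝ] ℝ, (∀ z, |ℓ z| ≤ ‖z‖) →
      P.real (A ℓ) ≤ Real.exp (ε / 2 / M - (ε / 2) ^ 2 * n / (2 * M ^ 2)) := fun ℓ hℓ =>
    measureReal_clm_sum_shift_le K hT hP hL hC hr0 hr1 hmix hξm hξ hξL hosc hℓ hM
      (by positivity) n
  have hsub : {x | ε < ‖(1 / (n : ℂ)) * ∑ j ∈ Finset.range n, ξ (shift^[j] x) - ∫ y, ξ y ∂P‖} ⊆
      (A Complex.reCLM ∪ A (-Complex.reCLM)) ∪ (A Complex.imCLM ∪ A (-Complex.imCLM)) := by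
    intro x hx
    obtain ⟨ℓ, hℓ, hle⟩ := exists_clm_ge_of_lt_norm hx
    have hmem : x ∈ A ℓ := by
      change n * (ε / 2) ≤ ∑ j ∈ Finset.range n, ℓ (ξ (shift^[j] x) - ∫ y, ξ y ∂P)
      have e : ∑ j ∈ Finset.range n, (ξ (shift^[j] x) - ∫ y, ξ y ∂P) =
          (n : ℝ) • ((1 / (n : ℂ)) * ∑ j ∈ Finset.range n, ξ (shift^[j] x) - ∫ y, ξ y ∂P) := by
        rw [Finset.sum_sub_distrib, Complex.real_smul]
        simp only [Finset.sum_const, Finset.card_range, nsmul_eq_mul, Complex.ofReal_natCast]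
        field_simp
      rw [← map_sum, e, map_smul, smul_eq_mul]
      exact mul_le_mul_of_nonneg_left hle (Nat.cast_nonneg n)
    simp only [List.mem_cons, List.not_mem_nil, or_false] at hℓ
    rcases hℓ with rfl | rfl | rfl | rfl
    · exact Or.inl (Or.inl hmem)
    · exact Or.inl (Or.inr hmem)
    · exact Or.inr (Or.inl hmem)
    · exact Or.inr (Or.inr hmem)
  have h1 := hA Complex.reCLM Complex.abs_re_le_norm
  have h2 := hA (-Complex.reCLM) fun z => by simpa using Complex.abs_re_le_norm z
  have h3 := hA Complex.imCLM Complex.abs_im_le_norm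
  have h4 := hA (-Complex.imCLM) fun z => by simpa using Complex.abs_im_le_norm z
  have h5 := measureReal_union_le (μ := P) (A Complex.reCLM) (A (-Complex.reCLM))
  have h6 := measureReal_union_le (μ := P) (A Complex.imCLM) (A (-Complex.imCLM))
  have h7 := measureReal_union_le (μ := P) (A Complex.reCLM ∪ A (-Complex.reCLM))
    (A Complex.imCLM ∪ A (-Complex.imCLM))
  have h8 := measureReal_mono (μ := P) hsub
  linarith

end Deviation

end MarkovShift

theorem mainTheorem3 {S : Type*} [MetricSpace S] [CompactSpace S] [MeasurableSpace S]
    [BorelSpace S] (K : Kernel S S) [IsMarkovKernel K] (α : ℝ) (hα0 : 0 < α) (hα1 : α ≤ 1)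
    (L : ℝ) :
    ∃ C > (0 : ℝ), ∃ k > (0 : ℝ), ∃ ε₀ > (0 : ℝ),
      ∀ (μ : Measure S) [IsProbabilityMeasure μ] (hμ : K.Invariant μ),
        MarkovShift.StronglyMixing K μ →
        ∀ ξ : (ℤ → S) → ℂ, MarkovShift.MemHolderPast α ξ →
          MarkovShift.holderNorm α ξ ≤ ENNReal.ofReal L →
          ∀ ε : ℝ, 0 < ε → ε < ε₀ → ∀ n : ℕ, 1 ≤ n →
            MarkovShift.kolmogorovExtension K μ hμ
                {x | ε < ‖(1 / (n : ℂ)) * ∑ j ∈ Finset.range n, ξ (MarkovShift.shift^[j] x) -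
                  ∫ y, ξ y ∂(MarkovShift.kolmogorovExtension K μ hμ)‖} ≤
              ENNReal.ofReal (C * Real.exp (-(k * ε ^ 2 * n))) := by
  by_cases hex : ∃ μ : Measure S, MarkovShift.StronglyMixing K μ
  swap
  · exact ⟨1, one_pos, 1, one_pos, 1, one_pos, fun μ _ _ h => absurd ⟨μ, h⟩ hex⟩
  -- The mixing constants of one stationary measure serve for all of them.
  obtain ⟨μ₀, hμ₀⟩ := hex
  obtain ⟨C, hC, ρ, hρ0, hρ1, hmix⟩ := hμ₀.exists_abs_integral_sub_le
  set r : ℝ := max ρ ((2 : ℝ) ^ (-α)) with hr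
  have hr0 : 0 ≤ r := hρ0.le.trans (le_max_left _ _)
  have hr1 : r < 1 := max_lt hρ1 (Real.rpow_lt_one_of_one_lt_of_neg one_lt_two (by linarith))
  set L' : ℝ := max L 1 with hL'
  have hL'0 : 0 < L' := one_pos.trans_le (le_max_right _ _)
  obtain ⟨M, hM⟩ : ∃ M : ℝ, M = (2 * L' + 2 * C * (2 * L')) * (2 / (1 - r)) := ⟨_, rfl⟩
  have hM0 : 0 < M := by
    have : 0 < 1 - r := by linarith
    rw [hM]; positivity
  refine ⟨4 * Real.exp (1 / (2 * M)), by positivity, 1 / (8 * M ^ 2), by positivity, 1, one_pos,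
    fun μ _ hμ _ ξ hξ hξL ε hε hε1 n hn => ?_⟩
  obtain ⟨hP1, hT, hP⟩ := MarkovShift.kolmogorovExtension_spec K μ hμ
  have hnorm : MarkovShift.holderNorm α ξ ≤ ENNReal.ofReal L' :=
    hξL.trans (ENNReal.ofReal_le_ofReal (le_max_left _ _))
  have hfin := MarkovShift.measureReal_norm_average_le K hT hP hL'0 hC hr0 hr1
    (fun c hc φ hφ hφc a s s' => (hmix c hc φ hφ hφc a s s').trans
      (mul_le_mul_of_nonneg_left (pow_le_pow_left₀ hρ0.le (le_max_left _ _) a) (by positivity)))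
    hξ.1.1 hξ.2.2
    (MarkovShift.norm_le_of_supNorm_le hL'0.le (le_self_add.trans hnorm))
    (fun b x x' h => (MarkovShift.norm_sub_le_of_holderNorm_le hL'0.le hξ.2.2 hnorm h).trans
      (mul_le_mul_of_nonneg_left (pow_le_pow_left₀ (by positivity) (le_max_right _ _) b)
        hL'0.le)) hM hε.le hn
  rw [← ofReal_measureReal]
  refine ENNReal.ofReal_le_ofReal (hfin.trans ?_)
  rw [mul_assoc, ← Real.exp_add]
  refine mul_le_mul_of_nonneg_left (Real.exp_le_exp.2 ?_) (by norm_num)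
  have h1 : ε / 2 / M ≤ 1 / (2 * M) := by
    rw [div_div]
    exact div_le_div_of_nonneg_right hε1.le (by positivity)
  have h2 : (ε / 2) ^ 2 * n / (2 * M ^ 2) = 1 / (8 * M ^ 2) * ε ^ 2 * n := by
    field_simp
    ring
  linarith
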